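/- **Setting.** Let $G$ be a finite group and $n\in\mathbb N$. On $\mathbb C[G^n]=\mathrm{span}\{|\mathbf g\rangle:\mathbf g\in G^n\}$ (the kets being orthonormal) consider the $Z$-type operators $Z^K_w|\mathbf g\rangle=\mathbb I\big(g_{q_1}^{a_1}\cdots g_{q_j}^{a_j}\in K\big)|\mathbf g\rangle$, for a subgroup $K\le G$ and a word $w=q_1^{a_1}\cdots q_j^{a_j}$ in the qudits ($q_i\in\{1,\dots,n\}$, possibly repeated, $a_i=\pm1$), and the $X$-type operators $X^{\mathbf a,\mathbf b}|\mathbf g\rangle=|\mathbf a\mathbf g\mathbf b^{-1}\rangle$ for $\mathbf a,\mathbf b\in G^n$. Let $\Sigma$ be a finite $2$-dimensional CW complex with $n$ oriented edges (multiple edges and self-loops are allowed, connectedness is not required), with $2$-cells glued along closed edge paths, and let $Y$ be a (possibly empty) set of its vertices, the *ghost vertices*. The associated *generalized (smooth if $Y=\emptyset$, rough otherwise) quantum double code* puts a $G$-qudit on every edge. Its checks are: for each vertex $v\notin Y$ and each $h\in G$, the $X$-type operator that multiplies the edges leaving $v$ by $h$ on the left and the edges entering $v$ by $h^{-1}$ on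 the right; and for each $2$-cell, the operator $Z^{\{1\}}_w$, where $w$ is its boundary word. The codespace $\mathcal C$ is the joint $+1$-eigenspace of all checks, and the log-dimension is $k=\log_{|G|}\dim\mathcal C$. The $Z$-distance $d_Z$ is the least number of distinct qudits occurring in the word $w$ of some $Z$-type operator $O=Z^K_w$ that violates the Knill–Laflamme condition "there is $c\in\mathbb C$ with $\langle\psi|O|\varphi\rangle=c\,\langle\psi|\varphi\rangle$ for all $\psi,\varphi\in\mathcal C$". **Theorem.** 1. For every such code with $k>1$, the $Z$-distance $d_Z$ is finite and $$d_Z\;\le\;2+\frac{2\log n}{\log\!\big(1+2(k-1)/n\big)} .$$ 2. Asymptotically, $k\,d_Z\le\Theta(n\log n)$: there is an absolute constant $A>0$ such that for every such code with $n\ge2$ and $k>0$, the $Z$-distance $d_Z$ is finite and $k\,d_Z\le A\,n\log n$. -/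

import Mathlib

universe u v

noncomputable section

namespace GroupCode

/-- The physical Hilbert space `ℂ[Gⁿ]` of `n` qudits valued in a finite group `G`. -/
abbrev Hilb (G : Type u) [Fintype G] (n : ℕ) : Type u :=
  EuclideanSpace ℂ (Fin n → G)

/-- The computational basis state `|g⟩`. -/
def ket {G : Type u} [Fintype G] {n : ℕ} (g : Fin n → G) : Hilb G n :=
  open Classical in EuclideanSpace.single g (1 : ℂ)

/-- A word in the qudits: a list of qudits `q` with orientations (`true` is `+1`, `false` is
`-1`). -/
abbrev QWord (n : ℕ) : Type := List (Fin n × Bool)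

/-- The product `g_{q₁}^{a₁} ⋯ g_{q_j}^{a_j}` along a word. -/
def evalWord {G : Type u} [Group G] {n : ℕ} (g : Fin n → G) (w : QWord n) : G :=
  (w.map fun p => if p.2 = true then g p.1 else (g p.1)⁻¹).prod

/-- The set of distinct qudits that occur in a word. -/
def wordSupport {n : ℕ} (w : QWord n) : Finset (Fin n) :=
  (w.map Prod.fst).toFinset

section Operators

variable {G : Type u} [Group G] [Fintype G] {n : ℕ}

/-- The `Z`-type operator `|g⟩ ↦ 𝕀(g_{q₁}^{a₁} ⋯ g_{q_j}^{a_j} ∈ K) |g⟩`. -/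
def zOp (K : Subgroup G) (w : QWord n) : Hilb G n →ₗ[ℂ] Hilb G n where
  toFun ψ := WithLp.toLp 2 fun g =>
    open Classical in if evalWord g w ∈ K then ψ g else 0
  map_add' ψ φ := by
    ext g
    by_cases h : evalWord g w ∈ K <;> simp [h]
  map_smul' c ψ := by
    ext g
    by_cases h : evalWord g w ∈ K <;> simp [h]

/-- The `X`-type operator `|g⟩ ↦ |a g b⁻¹⟩` (coordinatewise left and right multiplication). -/
def xOp (a b : Fin n → G) : Hilb G n →ₗ[ℂ] Hilb G n where
  toFun ψ := WithLp.toLp 2 fun g => ψ (a⁻¹ * g * b)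
  map_add' ψ φ := by ext g; simp
  map_smul' c ψ := by ext g; simp

open Classical in
theorem zOp_ket (K : Subgroup G) (w : QWord n) (g : Fin n → G) :
    zOp K w (ket g) = (if evalWord g w ∈ K then (1 : ℂ) else 0) • ket g := by
  ext g'
  by_cases h : g' = g
  · subst h
    by_cases hw : evalWord g' w ∈ K <;> simp [zOp, ket, hw]
  · by_cases hw : evalWord g w ∈ K <;> simp [zOp, ket, h, hw]

theorem xOp_ket (a b g : Fin n → G) : xOp a b (ket g) = ket (a * g * b⁻¹) := by
  classical
  ext g'
  have : a⁻¹ * g' * b = g ↔ g' = a * g * b⁻¹ := by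
    constructor
    · rintro rfl
      group
    · rintro rfl
      group
  simp [xOp, ket, this]

end Operators

/-- A group CSS code on `n` qudits: a set of `X`-checks `X^{a,b}` and a set of `Z`-checks
`Z^K_w`, such that each `X`-check preserves the joint `+1`-eigenspace of the `Z`-checks. -/
structure GroupCSSCode (G : Type u) [Group G] [Fintype G] (n : ℕ) where
  xChecks : Set ((Fin n → G) × (Fin n → G))
  zChecks : Set (Subgroup G × QWord n)
  preserves : ∀ x ∈ xChecks, ∀ ψ : Hilb G n, (∀ z ∈ zChecks, zOp z.1 z.2 ψ = ψ) →
    ∀ z ∈ zChecks, zOp z.1 z.2 (xOp x.1 x.2 ψ) = xOp x.1 x.2 ψ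

/-- The Knill–Laflamme condition for an operator `O` on a subspace `C`:
`⟨ψ|O|φ⟩ = c ⟨ψ|φ⟩` on `C`, with `c` depending only on `O`. -/
def KnillLaflamme {G : Type u} [Fintype G] {n : ℕ} (C : Submodule ℂ (Hilb G n))
    (O : Hilb G n →ₗ[ℂ] Hilb G n) : Prop :=
  ∃ c : ℂ, ∀ ψ ∈ C, ∀ φ ∈ C, inner ℂ ψ (O φ) = c * inner ℂ ψ φ

namespace GroupCSSCode

variable {G : Type u} [Group G] [Fintype G] {n : ℕ}

/-- The codespace: the joint `+1`-eigenspace of all checks. -/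
def codespace (S : GroupCSSCode G n) : Submodule ℂ (Hilb G n) where
  carrier := {ψ | (∀ x ∈ S.xChecks, xOp x.1 x.2 ψ = ψ) ∧ (∀ z ∈ S.zChecks, zOp z.1 z.2 ψ = ψ)}
  add_mem' := by
    rintro ψ φ ⟨h1, h2⟩ ⟨h3, h4⟩
    exact ⟨fun x hx => by rw [map_add, h1 x hx, h3 x hx],
      fun z hz => by rw [map_add, h2 z hz, h4 z hz]⟩
  zero_mem' := ⟨fun x _ => map_zero _, fun z _ => map_zero _⟩
  smul_mem' := by
    rintro c ψ ⟨h1, h2⟩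
    exact ⟨fun x hx => by rw [map_smul, h1 x hx], fun z hz => by rw [map_smul, h2 z hz]⟩

/-- The log-dimension `k = log_{|G|} dim C`. -/
def logDim (S : GroupCSSCode G n) : ℝ :=
  Real.logb (Fintype.card G) (Module.finrank ℂ S.codespace)

/-- The `Z`-distance: the least number of qudits on which some `Z`-type operator that violates
the Knill–Laflamme condition acts (`⊤` if there is no such operator). -/
def zDistance (S : GroupCSSCode G n) : ℕ∞ :=
  sInf {m : ℕ∞ | ∃ (K : Subgroup G) (w : QWord n),
    ¬ KnillLaflamme S.codespace (zOp K w) ∧ m = ((wordSupport w).card : ℕ∞)}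

/-- `d_Z > m` iff each `Z`-type operator on at most `m` qudits satisfies Knill–Laflamme. -/
theorem lt_zDistance_iff (S : GroupCSSCode G n) (m : ℕ) :
    (m : ℕ∞) < S.zDistance ↔ ∀ (K : Subgroup G) (w : QWord n), (wordSupport w).card ≤ m →
      KnillLaflamme S.codespace (zOp K w) := by
  constructor
  · intro h K w hw
    by_contra hKL
    have h1 : S.zDistance ≤ ((wordSupport w).card : ℕ∞) := sInf_le ⟨K, w, hKL, rfl⟩
    have h2 : ((wordSupport w).card : ℕ∞) ≤ m := by exact_mod_cast hw
    exact absurd h (not_lt.mpr (h1.trans h2))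
  · intro h
    have h1 : ((m + 1 : ℕ) : ℕ∞) ≤ S.zDistance := by
      refine le_sInf ?_
      rintro _ ⟨K, w, hKL, rfl⟩
      have : m + 1 ≤ (wordSupport w).card := by
        by_contra hlt
        exact hKL (h K w (by omega))
      exact_mod_cast this
    refine lt_of_lt_of_le ?_ h1
    exact_mod_cast Nat.lt_succ_self m

end GroupCSSCode

section Walks

variable {V : Type v} {n : ℕ}

/-- `IsWalk src tgt x w y`: the word `w` is an edge path from the vertex `x` to the vertex `y` in
the graph whose edge `q` runs from `src q` to `tgt q`; a letter `(q, true)` traverses `q` along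
its orientation, `(q, false)` against it. -/
def IsWalk (src tgt : Fin n → V) : V → QWord n → V → Prop
  | x, [], y => x = y
  | x, p :: w, y =>
      (if p.2 = true then src p.1 else tgt p.1) = x ∧
        IsWalk src tgt (if p.2 = true then tgt p.1 else src p.1) w y

/-- A gauge transformation multiplies the product along a walk at the two ends only. -/
theorem evalWord_gauge {G : Type u} [Group G] (src tgt : Fin n → V) (h : V → G)
    (g : Fin n → G) : ∀ (w : QWord n) (x y : V), IsWalk src tgt x w y →
      evalWord (fun q => h (src q) * g q * (h (tgt q))⁻¹) w = h x * evalWord g w * (h y)⁻¹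
  | [], x, y, hw => by
      have : x = y := hw
      simp [evalWord, this]
  | (q, true) :: w, x, y, hw => by
      obtain ⟨h1, h2⟩ := hw
      have ih := evalWord_gauge src tgt h g w _ _ h2
      simp only [evalWord, if_true, List.map_cons, List.prod_cons] at ih h1 ⊢
      rw [ih, ← h1]
      group
  | (q, false) :: w, x, y, hw => by
      obtain ⟨h1, h2⟩ := hw
      have ih := evalWord_gauge src tgt h g w _ _ h2
      simp only [evalWord, Bool.false_eq_true, if_false, List.map_cons, List.prod_cons]
        at ih h1 ⊢
      rw [ih, ← h1]
      group

end Walks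

/-- A 2-dimensional CW complex (in combinatorial form) with vertex set `V`, with `n` oriented
edges, and with 2-cells glued along closed edge paths, together with a (possibly empty) set of
ghost vertices. Multiple edges and edges from a vertex to itself are allowed. -/
structure GhostComplex (V : Type v) (n : ℕ) where
  src : Fin n → V
  tgt : Fin n → V
  faces : Set (QWord n)
  faces_closed : ∀ w ∈ faces, ∃ x, IsWalk src tgt x w x
  ghost : Set V

namespace GhostComplex

variable {V : Type v} {n : ℕ}

open Classical in
/-- The indicator vector that is `h` on the qudits `q` with `f q = x` and `1` elsewhere. -/
def vertexVec {G : Type u} [Group G] (f : Fin n → V) (x : V) (h : G) : Fin n → G :=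
  fun q => if f q = x then h else 1

/-- The (smooth or rough) quantum double code of a complex with ghost vertices: a qudit on each
edge; for each vertex `x` that is not a ghost and each `h : G` the `X`-check that multiplies the
edges leaving `x` by `h` on the left and the edges entering `x` by `h⁻¹` on the right; for each
2-cell the `Z`-check `Z^{1}` along its boundary. -/
def quantumDouble (Γ : GhostComplex V n) (G : Type u) [Group G] [Fintype G] :
    GroupCSSCode G n where
  xChecks := {p | ∃ x ∉ Γ.ghost, ∃ h : G, p = (vertexVec Γ.src x h, vertexVec Γ.tgt x h)}
  zChecks := {p | ∃ w ∈ Γ.faces, p = (⊥, w)}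
  preserves := by
    classical
    rintro _ ⟨x, -, h, rfl⟩ ψ hψ _ ⟨w, hw, rfl⟩
    obtain ⟨y, hy⟩ := Γ.faces_closed w hw
    ext g
    have key := evalWord_gauge Γ.src Γ.tgt (fun z => if z = x then h⁻¹ else 1) g w y y hy
    have hvec : (fun q => (if Γ.src q = x then h⁻¹ else 1) * g q *
        (if Γ.tgt q = x then h⁻¹ else 1)⁻¹) =
        (vertexVec Γ.src x h)⁻¹ * g * vertexVec Γ.tgt x h := by
      funext q
      by_cases h1 : Γ.src q = x <;> by_cases h2 : Γ.tgt q = x <;> simp [vertexVec, h1, h2]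
    rw [hvec] at key
    have hz := congrArg
      (fun φ : Hilb G n => φ ((vertexVec Γ.src x h)⁻¹ * g * vertexVec Γ.tgt x h))
      (hψ (⊥, w) ⟨w, hw, rfl⟩)
    by_cases hg : evalWord g w = 1
    · simp [zOp, xOp, hg]
    · have hne : evalWord ((vertexVec Γ.src x h)⁻¹ * g * vertexVec Γ.tgt x h) w ≠ 1 := by
        rw [key]
        intro hcon
        exact hg (conj_eq_one_iff.mp hcon)
      have hzero : ψ ((vertexVec Γ.src x h)⁻¹ * g * vertexVec Γ.tgt x h) = 0 := by
        simpa [zOp, Subgroup.mem_bot, hne] using hz.symm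
      simp [zOp, xOp, Subgroup.mem_bot, hg, hzero]

end GhostComplex

end GroupCode

end

/-!
The code states are the gauge-invariant functions on flat connections: `G`-labelings of the edges
with trivial holonomy around every 2-cell, where gauge transformations act at the non-ghost
vertices (`GhostComplex.mem_codespace_iff`). Identifying all ghost vertices with one extra vertex
at which gauge transformations are trivial makes the smooth and the rough case uniform.

Suppose that `d_Z > m`. The holonomy along a closed walk on at most `m` edges is trivial for the
trivial connection, so Knill–Laflamme forces it to be trivial for all flat connections
(`GhostComplex.evalWord_eq_one_of_knillLaflamme`). Hence an edge on a cycle of at most `m` edges is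
redundant: its label is determined by the rest of the cycle. A minimal set `T` of edges that
determines all flat connections therefore has no cycle on at most `m` edges
(`GhostComplex.exists_girthGT_determining`). Vertices of different components of `T` may be
identified without creating short cycles, so that `T` becomes connected on a vertex set `U`
(`GirthGT.exists_connected`); gauge transformations that are trivial at a root then act freely, and
counting orbits gives `k ≤ |T| - |U| + 1` (`finrank_mul_pow_le`).

What remains is the Moore bound of Alon, Hoory and Linial for irregular graphs
(`GirthGT.moore_of_two_le_degree`): a graph of minimum degree at least `2` and average degree `d`
without cycles on at most `2s` edges has at least `(d - 1)^s` vertices. The number of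
non-backtracking walks is bounded below by concavity of the logarithm (`sum_log_card_nbWalks`), and
above because short non-backtracking walks are determined by their ends
(`GirthGT.eq_of_isReduced`). With `d - 1 ≥ 1 + 2(k - 1)/n` this is the first bound; the second
follows from `log (1 + x) ≥ x/2` on `[0, 1]`, together with the fact that a forest has
fewer edges than vertices when `k` is small.
-/

namespace GroupCode

/-! ### Walks, connections and gauge transformations -/

section Walks

variable {V : Type v} {n : ℕ} {src tgt : Fin n → V}

theorem IsWalk.append : ∀ {w₁ w₂ : QWord n} {x y z : V}, IsWalk src tgt x w₁ y →
    IsWalk src tgt y w₂ z → IsWalk src tgt x (w₁ ++ w₂) z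
  | [], _, _, _, _, h₁, h₂ => by
      have h : _ = _ := h₁
      simpa [h] using h₂
  | _ :: _, _, _, _, _, h₁, h₂ => ⟨h₁.1, h₁.2.append h₂⟩

theorem IsWalk.map {W : Type*} (f : V → W) : ∀ {w : QWord n} {x y : V}, IsWalk src tgt x w y →
    IsWalk (f ∘ src) (f ∘ tgt) (f x) w (f y)
  | [], _, _, h => congrArg f h
  | (_, true) :: _, _, _, h => ⟨congrArg f h.1, h.2.map f⟩
  | (_, false) :: _, _, _, h => ⟨congrArg f h.1, h.2.map f⟩

theorem evalWord_cons {G : Type u} [Group G] (g : Fin n → G) (p : Fin n × Bool) (w : QWord n) :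
    evalWord g (p :: w) = (if p.2 = true then g p.1 else (g p.1)⁻¹) * evalWord g w := by
  simp [evalWord]

theorem evalWord_congr {G : Type u} [Group G] {g g' : Fin n → G} {w : QWord n}
    (h : ∀ p ∈ w, g p.1 = g' p.1) : evalWord g w = evalWord g' w := by
  unfold evalWord
  congr 1
  exact List.map_congr_left fun p hp => by rw [h p hp]

theorem evalWord_one {G : Type u} [Group G] (w : QWord n) :
    evalWord (1 : Fin n → G) w = 1 := by
  induction w with
  | nil => rfl
  | cons p w ih => simp [evalWord_cons, ih]

theorem mem_wordSupport {w : QWord n} {q : Fin n} : q ∈ wordSupport w ↔ ∃ p ∈ w, p.1 = q := by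
  simp [wordSupport]

theorem wordSupport_subset {w : QWord n} {T : Finset (Fin n)} :
    wordSupport w ⊆ T ↔ ∀ p ∈ w, p.1 ∈ T := by
  simp only [Finset.subset_iff, mem_wordSupport]
  exact ⟨fun h p hp => h ⟨p, hp, rfl⟩, fun h q ⟨p, hp, e⟩ => e ▸ h p hp⟩

/-- The gauge transform of a connection `g` by `h`: the connection `h(src q) g_q h(tgt q)⁻¹`. -/
def gauge {G : Type u} [Group G] (src tgt : Fin n → V) (h : V → G) (g : Fin n → G) : Fin n → G :=
  fun q => h (src q) * g q * (h (tgt q))⁻¹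

theorem gauge_mul {G : Type u} [Group G] (h₁ h₂ : V → G) (g : Fin n → G) :
    gauge src tgt (h₁ * h₂) g = gauge src tgt h₁ (gauge src tgt h₂ g) := by
  funext q
  simp [gauge, mul_assoc]

theorem gauge_one {G : Type u} [Group G] (g : Fin n → G) :
    gauge src tgt (1 : V → G) g = g := by
  funext q
  simp [gauge]

theorem evalWord_gauge_eq_one_iff {G : Type u} [Group G] (h : V → G) (g : Fin n → G)
    {w : QWord n} {x : V} (hw : IsWalk src tgt x w x) :
    evalWord (gauge src tgt h g) w = 1 ↔ evalWord g w = 1 := by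
  unfold gauge
  rw [evalWord_gauge src tgt h g w x x hw, conj_eq_one_iff]

end Walks

/-! ### Girth and identification of vertices -/

section Girth

variable {V : Type v} {n : ℕ} {src tgt : Fin n → V} {T : Finset (Fin n)} {m : ℕ}

/-- The subgraph with edge set `T` has no cycle on at most `m` edges. A cycle is encoded as an
edge `e ∈ T` together with a walk in `T` from its target back to its source that avoids `e`. -/
def GirthGT (src tgt : Fin n → V) (T : Finset (Fin n)) (m : ℕ) : Prop :=
  ∀ e ∈ T, ∀ p : QWord n, IsWalk src tgt (tgt e) p (src e) → (∀ l ∈ p, l.1 ∈ T ∧ l.1 ≠ e) →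
    m < (wordSupport p).card + 1

/-- A set of vertices that no edge of `T` leaves, i.e. a union of connected components of the
subgraph with edge set `T`. -/
def IsEdgeClosed (src tgt : Fin n → V) (T : Finset (Fin n)) (c : Set V) : Prop :=
  ∀ e ∈ T, src e ∈ c ↔ tgt e ∈ c

theorem GirthGT.mono (h : GirthGT src tgt T m) {S : Finset (Fin n)} (hS : S ⊆ T) :
    GirthGT src tgt S m :=
  fun e he p hp hl => h e (hS he) p hp fun l hlp => ⟨hS (hl l hlp).1, (hl l hlp).2⟩

theorem IsEdgeClosed.compl {c : Set V} (h : IsEdgeClosed src tgt T c) :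
    IsEdgeClosed src tgt T cᶜ :=
  fun e he => not_congr (h e he)

/-- In a forest (no cycle on at most `m` edges, and at most `m` edges in total), the two ends of
an edge are separated once the edge is removed. -/
theorem GirthGT.exists_separating (h : GirthGT src tgt T m) (hT : T.card ≤ m) {e : Fin n}
    (he : e ∈ T) :
    ∃ c : Set V, IsEdgeClosed src tgt (T.erase e) c ∧ tgt e ∈ c ∧ src e ∉ c := by
  refine ⟨{z | ∃ p : QWord n, IsWalk src tgt (tgt e) p z ∧ ∀ l ∈ p, l.1 ∈ T.erase e}, ?_,
    ⟨[], rfl, by simp⟩, ?_⟩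
  · intro q hq
    constructor
    · rintro ⟨p, hp, hl⟩
      refine ⟨p ++ [(q, true)], hp.append ⟨rfl, rfl⟩, ?_⟩
      simp only [List.mem_append, List.mem_singleton]
      rintro l (hl' | rfl)
      exacts [hl l hl', hq]
    · rintro ⟨p, hp, hl⟩
      refine ⟨p ++ [(q, false)], hp.append ⟨rfl, rfl⟩, ?_⟩
      simp only [List.mem_append, List.mem_singleton]
      rintro l (hl' | rfl)
      exacts [hl l hl', hq]
  · rintro ⟨p, hp, hl⟩
    have h1 := h e he p hp fun l hlp =>
      ⟨Finset.mem_of_mem_erase (hl l hlp), Finset.ne_of_mem_erase (hl l hlp)⟩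
    have h2 := Finset.card_le_card (wordSupport_subset.2 hl)
    have h3 := Finset.card_erase_add_one he
    omega

/-- The map that identifies the vertex `y` with the vertex `x`. -/
noncomputable def mergeTo (x y : V) (z : V) : V :=
  open Classical in if z = y then x else z

/-- If `f` factors through the identification `q` and each edge is either fixed or collapsed
by `f`, a walk in the identified graph projects to a walk in the original graph: the letters of
the collapsed edges are dropped. -/
theorem IsWalk.collapse {q f : V → V} (hq : ∀ z, f (q z) = f z) :
    ∀ {w : QWord n} {x y : V}, (∀ l ∈ w, (f (src l.1) = src l.1 ∧ f (tgt l.1) = tgt l.1) ∨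
      f (src l.1) = f (tgt l.1)) → IsWalk (q ∘ src) (q ∘ tgt) x w y →
      ∃ w' : QWord n, w' ⊆ w ∧ IsWalk src tgt (f x) w' (f y)
  | [], x, y, _, h => ⟨[], List.Subset.refl _, congrArg f h⟩
  | (e, b) :: w, x, y, hf, h => by
      obtain ⟨w', hw', hwalk⟩ := IsWalk.collapse hq
        (fun l hl => hf l (List.mem_cons_of_mem _ hl)) h.2
      have hx : f (if b = true then src e else tgt e) = f x := by
        have h1 := congrArg f h.1
        cases b <;> simpa [hq] using h1
      have hwalk' : IsWalk src tgt (f (if b = true then tgt e else src e)) w' (f y) := by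
        cases b <;> simpa [hq] using hwalk
      rcases hf (e, b) List.mem_cons_self with ⟨h1, h2⟩ | h1
      · refine ⟨(e, b) :: w', List.cons_subset_cons _ hw', ?_, ?_⟩
        · rw [← hx]
          cases b <;> simp_all
        · cases b <;> simp_all
      · refine ⟨w', List.subset_cons_of_subset _ hw', ?_⟩
        rw [← hx]
        cases b <;> simp_all

/-- An edge `e` fixed by the collapsing map `f` lies on no short cycle of the identified graph:
such a cycle would project to one of the original graph on a subset of its edges. -/
theorem GirthGT.of_collapse {q f : V → V} (hq : ∀ z, f (q z) = f z) (h : GirthGT src tgt T m)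
    (hf : ∀ e ∈ T, (f (src e) = src e ∧ f (tgt e) = tgt e) ∨ f (src e) = f (tgt e))
    {e : Fin n} (he : e ∈ T) (hs : f (src e) = src e) (ht : f (tgt e) = tgt e) {p : QWord n}
    (hp : IsWalk (q ∘ src) (q ∘ tgt) ((q ∘ tgt) e) p ((q ∘ src) e))
    (hl : ∀ l ∈ p, l.1 ∈ T ∧ l.1 ≠ e) : m < (wordSupport p).card + 1 := by
  obtain ⟨p', hsub, hp'⟩ := hp.collapse hq fun l hlp => hf l.1 (hl l hlp).1
  simp only [Function.comp_apply, hq, hs, ht] at hp'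
  have h1 := h e he p' hp' fun l hlp => hl l (hsub hlp)
  have h2 : wordSupport p' ⊆ wordSupport p :=
    wordSupport_subset.2 fun l hlp => mem_wordSupport.2 ⟨l, hsub hlp, rfl⟩
  have := Finset.card_le_card h2
  omega

/-- Identifying two vertices of different components creates no short cycle. -/
theorem GirthGT.merge (h : GirthGT src tgt T m) {c : Set V} (hc : IsEdgeClosed src tgt T c)
    {x y : V} (hx : x ∈ c) (hy : y ∉ c) :
    GirthGT (mergeTo x y ∘ src) (mergeTo x y ∘ tgt) T m := by
  classical
  intro e he p hp hl
  -- the component of `e` misses one of `x`, `y`; collapse everything outside `c` (or outside its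
  -- complement) to the other one
  by_cases hec : src e ∈ c
  · refine GirthGT.of_collapse (f := fun z => if z ∈ c then z else x) ?_ h ?_ he ?_ ?_ hp hl
    · intro z
      by_cases hz : z = y
      · subst hz
        simp [mergeTo, hx, hy]
      · simp [mergeTo, hz]
    · intro d hd
      have := hc d hd
      by_cases hdc : src d ∈ c
      · left
        simp [hdc, this.1 hdc]
      · right
        simp [hdc, mt this.2 hdc]
    · simp [hec]
    · simp [(hc e he).1 hec]
  · refine GirthGT.of_collapse (f := fun z => if z ∈ c then y else z) ?_ h ?_ he ?_ ?_ hp hl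
    · intro z
      by_cases hz : z = y
      · subst hz
        simp [mergeTo, hx, hy]
      · simp [mergeTo, hz]
    · intro d hd
      have := hc d hd
      by_cases hdc : src d ∈ c
      · right
        simp [hdc, this.1 hdc]
      · left
        simp [hdc, mt this.2 hdc]
    · simp [hec]
    · simp [mt (hc e he).2 hec]

theorem mergeTo_image_subset [DecidableEq V] {U : Finset V} {x y : V} (hx : x ∈ U)
    (hxy : x ≠ y) : U.image (mergeTo x y) ⊆ U.erase y := by
  intro z hz
  obtain ⟨u, hu, rfl⟩ := Finset.mem_image.1 hz
  by_cases huy : u = y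
  · simp [mergeTo, huy, hx, hxy]
  · simp [mergeTo, huy, hu]

/-- A forest has fewer edges than vertices. -/
theorem GirthGT.card_lt_card (U : Finset V) (h : GirthGT src tgt T m) (hT : T.card ≤ m)
    (hU : U.Nonempty) (hs : ∀ e ∈ T, src e ∈ U) (ht : ∀ e ∈ T, tgt e ∈ U) :
    T.card < U.card := by
  classical
  induction T using Finset.strongInduction generalizing src tgt U with
  | H T ih =>
    rcases T.eq_empty_or_nonempty with rfl | ⟨e, he⟩
    · simpa using hU
    obtain ⟨c, hc, htc, hsc⟩ := h.exists_separating hT he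
    have hne : src e ≠ tgt e := fun hst => hsc (hst ▸ htc)
    have hsub := mergeTo_image_subset (hs e he) hne
    have hmem : ∀ z ∈ U, mergeTo (src e) (tgt e) z ∈ U.erase (tgt e) :=
      fun z hz => hsub (Finset.mem_image_of_mem _ hz)
    have key := ih (T.erase e) (Finset.erase_ssubset he) (U.erase (tgt e))
      ((h.mono (T.erase_subset e)).merge hc.compl hsc (by simpa using htc))
      ((Finset.card_le_card (T.erase_subset e)).trans hT)
      ⟨src e, Finset.mem_erase.2 ⟨hne, hs e he⟩⟩
      (fun d hd => hmem _ (hs d (Finset.mem_of_mem_erase hd)))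
      (fun d hd => hmem _ (ht d (Finset.mem_of_mem_erase hd)))
    have h1 := Finset.card_erase_add_one he
    have h2 := Finset.card_erase_add_one (ht e he)
    omega

/-- On a forest each connection is a pure gauge. -/
theorem GirthGT.exists_gauge {G : Type u} [Group G] (g : Fin n → G) (h : GirthGT src tgt T m)
    (hT : T.card ≤ m) : ∃ k : V → G, ∀ e ∈ T, g e = k (src e) * (k (tgt e))⁻¹ := by
  classical
  induction T using Finset.strongInduction with
  | H T ih =>
    rcases T.eq_empty_or_nonempty with rfl | ⟨e, he⟩
    · exact ⟨1, by simp⟩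
    obtain ⟨k, hk⟩ := ih (T.erase e) (Finset.erase_ssubset he) (h.mono (T.erase_subset e))
      ((Finset.card_le_card (T.erase_subset e)).trans hT)
    obtain ⟨c, hc, htc, hsc⟩ := h.exists_separating hT he
    -- correct the gauge of the forest without `e` by a constant on the side of `tgt e`
    refine ⟨fun z => if z ∈ c then k z * ((k (tgt e))⁻¹ * (g e)⁻¹ * k (src e)) else k z, ?_⟩
    intro d hd
    by_cases hde : d = e
    · subst hde
      simp [htc, hsc]
      group
    · have hd' : d ∈ T.erase e := Finset.mem_erase.2 ⟨hde, hd⟩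
      by_cases hdc : src d ∈ c
      · simp only [hdc, (hc d hd').1 hdc, if_true, hk d hd']
        group
      · simp only [hdc, mt (hc d hd').2 hdc, if_false, hk d hd']

/-- In a graph without short cycles, two short non-backtracking walks with the same ends are
equal. All connections on the union of their edges are pure gauges, in particular the tautological
one with values in the free group on the edges, so the two walks spell the same element of the free
group; being reduced, they are equal as words. -/
theorem GirthGT.eq_of_isReduced (h : GirthGT src tgt T m) {w₁ w₂ : QWord n} {x y : V}
    (h₁ : IsWalk src tgt x w₁ y) (h₂ : IsWalk src tgt x w₂ y) (hr₁ : FreeGroup.IsReduced w₁)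
    (hr₂ : FreeGroup.IsReduced w₂) (hT₁ : ∀ l ∈ w₁, l.1 ∈ T) (hT₂ : ∀ l ∈ w₂, l.1 ∈ T)
    (hm : w₁.length + w₂.length ≤ m) : w₁ = w₂ := by
  classical
  have heval : ∀ w : QWord n, evalWord (FreeGroup.of : Fin n → FreeGroup (Fin n)) w =
      FreeGroup.mk w := by
    intro w
    induction w with
    | nil => rfl
    | cons p w ih =>
      rw [evalWord_cons, ih]
      obtain ⟨q, b⟩ := p
      cases b <;> simp [FreeGroup.of, FreeGroup.invRev]
  set S := wordSupport w₁ ∪ wordSupport w₂ with hS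
  have hST : S ⊆ T := Finset.union_subset (wordSupport_subset.2 hT₁) (wordSupport_subset.2 hT₂)
  have hlen : ∀ w : QWord n, (wordSupport w).card ≤ w.length := fun w =>
    (List.toFinset_card_le _).trans (by simp)
  have hScard : S.card ≤ m :=
    (Finset.card_union_le _ _).trans ((add_le_add (hlen w₁) (hlen w₂)).trans hm)
  obtain ⟨k, hk⟩ := (h.mono hST).exists_gauge
    (FreeGroup.of : Fin n → FreeGroup (Fin n)) hScard
  have hval : ∀ w : QWord n, IsWalk src tgt x w y → (∀ l ∈ w, l.1 ∈ S) →
      FreeGroup.mk w = k x * (k y)⁻¹ := by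
    intro w hw hwS
    have := evalWord_gauge src tgt k 1 w x y hw
    rw [evalWord_one, mul_one] at this
    rw [← this, ← heval]
    exact evalWord_congr fun l hl => by simpa using hk l.1 (hwS l hl)
  have hval₁ := hval w₁ h₁ fun l hl => Finset.mem_union_left _ (mem_wordSupport.2 ⟨l, hl, rfl⟩)
  have hval₂ := hval w₂ h₂ fun l hl => Finset.mem_union_right _ (mem_wordSupport.2 ⟨l, hl, rfl⟩)
  have heq := hval₁.trans hval₂.symm
  rw [← hr₁.reduce_eq, ← hr₂.reduce_eq]
  simpa only [FreeGroup.toWord_mk] using congrArg FreeGroup.toWord heq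

end Girth

/-! ### The Moore bound for irregular multigraphs -/

section Moore

theorem log_card_add_inv_mul_sum_log_le {ι : Type*} {s : Finset ι} (hs : s.Nonempty)
    {a : ι → ℝ} (ha : ∀ i ∈ s, 0 < a i) :
    Real.log s.card + (s.card : ℝ)⁻¹ * ∑ i ∈ s, Real.log (a i) ≤ Real.log (∑ i ∈ s, a i) := by
  have hc : (0 : ℝ) < s.card := by exact_mod_cast hs.card_pos
  have h := strictConcaveOn_log_Ioi.concaveOn.le_map_sum (t := s)
    (w := fun _ => (s.card : ℝ)⁻¹) (p := a) (fun _ _ => by positivity)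
    (by simp [hc.ne']) (fun i hi => ha i hi)
  simp only [smul_eq_mul, ← Finset.mul_sum] at h
  have hpos : 0 < ∑ i ∈ s, a i := Finset.sum_pos ha hs
  rw [Real.log_mul (by positivity) hpos.ne', Real.log_inv] at h
  linarith

theorem convexOn_add_one_mul_log : ConvexOn ℝ (Set.Ici 1) fun x : ℝ => (x + 1) * Real.log x := by
  have hd : ∀ x : ℝ, 1 ≤ x →
      HasDerivAt (fun x : ℝ => (x + 1) * Real.log x) (1 * Real.log x + (x + 1) * x⁻¹) x := by
    intro x hx
    exact ((hasDerivAt_id x).add_const 1).mul (Real.hasDerivAt_log (by linarith))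
  refine MonotoneOn.convexOn_of_deriv (convex_Ici 1)
    (fun x hx => (hd x hx).continuousAt.continuousWithinAt)
    (fun x hx => ?_) ?_
  · rw [interior_Ici] at hx
    exact (hd x (le_of_lt hx)).differentiableAt.differentiableWithinAt
  · rw [interior_Ici]
    intro x hx y hy hxy
    simp only [Set.mem_Ioi] at hx hy
    rw [(hd x hx.le).deriv, (hd y hy.le).deriv]
    -- the derivative is `log x + 1 + 1/x`, and `log (y/x) ≥ 1 - x/y ≥ 1/x - 1/y`
    have h1 := Real.one_sub_inv_le_log_of_pos (x := y / x) (by positivity)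
    rw [Real.log_div (by positivity) (by positivity), inv_div] at h1
    have h2 : (x + 1) * x⁻¹ = 1 + 1 / x := by field_simp
    have h3 : (y + 1) * y⁻¹ = 1 + 1 / y := by field_simp
    have h4 : (1 - x / y) - (1 / x - 1 / y) = (y - x) * (x - 1) / (x * y) := by
      field_simp
    have h5 : 0 ≤ (y - x) * (x - 1) / (x * y) :=
      div_nonneg (mul_nonneg (by linarith) (by linarith)) (by positivity)
    rw [h2, h3]
    linarith

variable {V : Type v} {n : ℕ} {src tgt : Fin n → V} {T : Finset (Fin n)} {m : ℕ}

/-- The tail of a dart (an edge with a direction of traversal). -/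
def dartTail (src tgt : Fin n → V) (d : Fin n × Bool) : V := if d.2 = true then src d.1 else tgt d.1

/-- The head of a dart. -/
def dartHead (src tgt : Fin n → V) (d : Fin n × Bool) : V := if d.2 = true then tgt d.1 else src d.1

/-- The same edge traversed backwards. -/
def dartRev (d : Fin n × Bool) : Fin n × Bool := (d.1, !d.2)

theorem dartRev_rev (d : Fin n × Bool) : dartRev (dartRev d) = d := by simp [dartRev]

theorem dartTail_rev (d : Fin n × Bool) :
    dartTail src tgt (dartRev d) = dartHead src tgt d := by
  obtain ⟨e, b⟩ := d
  cases b <;> simp [dartTail, dartHead, dartRev]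

theorem dartHead_rev (d : Fin n × Bool) :
    dartHead src tgt (dartRev d) = dartTail src tgt d := by
  obtain ⟨e, b⟩ := d
  cases b <;> simp [dartTail, dartHead, dartRev]

theorem eq_dartRev_iff (d f : Fin n × Bool) : f = dartRev d ↔ ¬ (d.1 = f.1 → d.2 = f.2) := by
  obtain ⟨e, b⟩ := d
  obtain ⟨e', b'⟩ := f
  cases b <;> cases b' <;> simp [dartRev, eq_comm]

/-- The darts of the subgraph with edge set `T`. -/
def darts (T : Finset (Fin n)) : Finset (Fin n × Bool) := T ×ˢ Finset.univ

theorem mem_darts {d : Fin n × Bool} : d ∈ darts T ↔ d.1 ∈ T := by simp [darts]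

theorem dartRev_mem {d : Fin n × Bool} : dartRev d ∈ darts T ↔ d ∈ darts T := by
  simp [mem_darts, dartRev]

theorem card_darts : (darts T).card = 2 * T.card := by
  simp [darts, mul_comm]

/-- The darts of `T` that leave the vertex `v`; a loop at `v` contributes two. -/
noncomputable def outDarts (src tgt : Fin n → V) (T : Finset (Fin n)) (v : V) :
    Finset (Fin n × Bool) :=
  open Classical in (darts T).filter fun d => dartTail src tgt d = v

/-- The degree of `v` in the subgraph with edge set `T`; a loop counts twice. -/
noncomputable def degree (src tgt : Fin n → V) (T : Finset (Fin n)) (v : V) : ℕ :=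
  (outDarts src tgt T v).card

/-- The darts of `T` that may follow `d` in a non-backtracking walk. -/
noncomputable def nextDarts (src tgt : Fin n → V) (T : Finset (Fin n)) (d : Fin n × Bool) :
    Finset (Fin n × Bool) :=
  (outDarts src tgt T (dartHead src tgt d)).erase (dartRev d)

/-- The non-backtracking walks of `t + 1` steps in `T` whose first dart is `d`. -/
noncomputable def nbWalks (src tgt : Fin n → V) (T : Finset (Fin n)) :
    ℕ → Fin n × Bool → Finset (QWord n)
  | 0, d => {[d]}
  | t + 1, d => (nextDarts src tgt T d).biUnion fun f => (nbWalks src tgt T t f).image (List.cons d)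

theorem mem_outDarts {d : Fin n × Bool} {v : V} :
    d ∈ outDarts src tgt T v ↔ d ∈ darts T ∧ dartTail src tgt d = v := by
  simp [outDarts]

theorem mem_nextDarts {d f : Fin n × Bool} : f ∈ nextDarts src tgt T d ↔
    f ∈ darts T ∧ dartTail src tgt f = dartHead src tgt d ∧ f ≠ dartRev d := by
  rw [nextDarts, Finset.mem_erase, mem_outDarts]
  tauto

theorem card_nextDarts {d : Fin n × Bool} (hd : d ∈ darts T) :
    (nextDarts src tgt T d).card + 1 = degree src tgt T (dartHead src tgt d) :=
  Finset.card_erase_add_one (mem_outDarts.2 ⟨dartRev_mem.2 hd, dartTail_rev d⟩)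

/-- The number of darts that may precede `f` in a non-backtracking walk. -/
theorem card_prevDarts {f : Fin n × Bool} (hf : f ∈ darts T) :
    ((darts T).filter fun d => f ∈ nextDarts src tgt T d).card + 1 =
      degree src tgt T (dartTail src tgt f) := by
  have h := card_nextDarts (src := src) (tgt := tgt) (dartRev_mem.2 hf)
  rw [dartHead_rev] at h
  rw [← h]
  congr 1
  refine Finset.card_bij' (fun d _ => dartRev d) (fun d _ => dartRev d) ?_ ?_
    (fun d _ => dartRev_rev d) (fun d _ => dartRev_rev d)
  · intro d hd
    obtain ⟨h1, h2⟩ := Finset.mem_filter.1 hd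
    obtain ⟨-, h3, h4⟩ := mem_nextDarts.1 h2
    refine mem_nextDarts.2 ⟨dartRev_mem.2 h1, ?_, ?_⟩
    · rw [dartTail_rev, dartHead_rev, h3]
    · rw [dartRev_rev]
      rintro rfl
      exact h4 rfl
  · intro d hd
    obtain ⟨h1, h2, h3⟩ := mem_nextDarts.1 hd
    refine Finset.mem_filter.2 ⟨dartRev_mem.2 h1, mem_nextDarts.2 ⟨hf, ?_, ?_⟩⟩
    · rw [dartHead_rev, h2, dartHead_rev]
    · rw [dartRev_rev]
      rintro rfl
      rw [dartRev_rev] at h3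
      exact h3 rfl

theorem exists_cons_of_mem_nbWalks {t : ℕ} {d : Fin n × Bool} {w : QWord n}
    (hw : w ∈ nbWalks src tgt T t d) : ∃ w', w = d :: w' := by
  cases t with
  | zero => exact ⟨[], by simpa [nbWalks] using hw⟩
  | succ t =>
    simp only [nbWalks, Finset.mem_biUnion, Finset.mem_image] at hw
    obtain ⟨f, -, w', -, rfl⟩ := hw
    exact ⟨w', rfl⟩

theorem mem_nbWalks {t : ℕ} : ∀ {d : Fin n × Bool} {w : QWord n}, d ∈ darts T →
    w ∈ nbWalks src tgt T t d → w.length = t + 1 ∧ FreeGroup.IsReduced w ∧ (∀ l ∈ w, l.1 ∈ T) ∧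
      ∃ f ∈ darts T, IsWalk src tgt (dartTail src tgt d) w (dartHead src tgt f) := by
  induction t with
  | zero =>
    intro d w hd hw
    obtain rfl : w = [d] := by simpa [nbWalks] using hw
    exact ⟨rfl, FreeGroup.IsReduced.singleton, by simpa [mem_darts] using hd, d, hd, rfl, rfl⟩
  | succ t ih =>
    intro d w hd hw
    simp only [nbWalks, Finset.mem_biUnion, Finset.mem_image] at hw
    obtain ⟨f, hf, w', hw', rfl⟩ := hw
    obtain ⟨hfT, hft, hfd⟩ := mem_nextDarts.1 hf
    obtain ⟨h1, h2, h3, f', hf', h4⟩ := ih hfT hw'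
    refine ⟨by simp [h1], ?_, ?_, f', hf', rfl, ?_⟩
    · obtain ⟨w'', rfl⟩ := exists_cons_of_mem_nbWalks hw'
      rw [FreeGroup.isReduced_cons_cons]
      exact ⟨not_not.1 (mt (eq_dartRev_iff d f).2 hfd), h2⟩
    · intro l hl
      rcases List.mem_cons.1 hl with rfl | hl
      exacts [mem_darts.1 hd, h3 l hl]
    · rw [hft] at h4
      exact h4

theorem card_nbWalks_succ (t : ℕ) (d : Fin n × Bool) : (nbWalks src tgt T (t + 1) d).card =
    ∑ f ∈ nextDarts src tgt T d, (nbWalks src tgt T t f).card := by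
  rw [nbWalks, Finset.card_biUnion]
  · exact Finset.sum_congr rfl fun f _ => Finset.card_image_of_injective _ List.cons_injective
  · intro f _ f' _ hff'
    rw [Function.onFun, Finset.disjoint_left]
    intro w hw hw'
    obtain ⟨w₁, h₁, rfl⟩ := Finset.mem_image.1 hw
    obtain ⟨w₂, h₂, h⟩ := Finset.mem_image.1 hw'
    obtain ⟨x₁, rfl⟩ := exists_cons_of_mem_nbWalks h₁
    obtain ⟨x₂, rfl⟩ := exists_cons_of_mem_nbWalks h₂
    simp only [List.cons.injEq, true_and] at h
    exact hff' h.1.symm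

theorem card_nbWalks_pos (hdeg : ∀ d ∈ darts T, 2 ≤ degree src tgt T (dartHead src tgt d)) (t : ℕ) :
    ∀ d ∈ darts T, 0 < (nbWalks src tgt T t d).card := by
  induction t with
  | zero => simp [nbWalks]
  | succ t ih =>
    intro d hd
    rw [card_nbWalks_succ]
    refine Finset.sum_pos (fun f hf => ih f (mem_nextDarts.1 hf).1) (Finset.card_pos.1 ?_)
    have := card_nextDarts (src := src) (tgt := tgt) hd
    have := hdeg d hd
    omega

/-- The entropy estimate for non-backtracking walks: on average over the first dart, the logarithm
of the number of continuations grows at each step by the average of `log (deg - 1)`. The reason is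
concavity of the logarithm together with the fact that the uniform distribution on darts is
stationary for the non-backtracking random walk. -/
theorem sum_log_card_nbWalks
    (hdeg : ∀ d ∈ darts T, 2 ≤ degree src tgt T (dartHead src tgt d)) (t : ℕ) :
    t * ∑ d ∈ darts T, Real.log ((degree src tgt T (dartHead src tgt d) : ℝ) - 1) ≤
      ∑ d ∈ darts T, Real.log (nbWalks src tgt T t d).card := by
  classical
  induction t with
  | zero => simp [nbWalks]
  | succ t ih =>
    have hnext : ∀ d ∈ darts T, ((nextDarts src tgt T d).card : ℝ) =
        (degree src tgt T (dartHead src tgt d) : ℝ) - 1 := by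
      intro d hd
      rw [← card_nextDarts hd]
      simp
    have hstep : ∀ d ∈ darts T, Real.log ((degree src tgt T (dartHead src tgt d) : ℝ) - 1) +
        ∑ f ∈ nextDarts src tgt T d, ((degree src tgt T (dartTail src tgt f) : ℝ) - 1)⁻¹ *
          Real.log (nbWalks src tgt T t f).card ≤
        Real.log (nbWalks src tgt T (t + 1) d).card := by
      intro d hd
      have hne : (nextDarts src tgt T d).Nonempty := by
        have := card_nextDarts (src := src) (tgt := tgt) hd
        have := hdeg d hd
        exact Finset.card_pos.1 (by omega)
      have h := log_card_add_inv_mul_sum_log_le hne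
        (a := fun f => ((nbWalks src tgt T t f).card : ℝ))
        fun f hf => by exact_mod_cast card_nbWalks_pos hdeg t f (mem_nextDarts.1 hf).1
      rw [card_nbWalks_succ]
      push_cast
      rw [hnext d hd, Finset.mul_sum] at h
      refine le_trans (le_of_eq ?_) h
      congr 1
      exact Finset.sum_congr rfl fun f hf => by rw [(mem_nextDarts.1 hf).2.1]
    -- stationarity: in the sum over all `d`, a dart `f` occurs once for each of its `deg - 1`
    -- predecessors, each time with weight `1 / (deg - 1)`
    have hstat : ∑ d ∈ darts T, ∑ f ∈ nextDarts src tgt T d,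
        ((degree src tgt T (dartTail src tgt f) : ℝ) - 1)⁻¹ *
          Real.log (nbWalks src tgt T t f).card =
        ∑ f ∈ darts T, Real.log (nbWalks src tgt T t f).card := by
      rw [Finset.sum_comm' (t' := darts T)
        (s' := fun f => (darts T).filter fun d => f ∈ nextDarts src tgt T d)]
      · refine Finset.sum_congr rfl fun f hf => ?_
        rw [Finset.sum_const, nsmul_eq_mul, ← mul_assoc]
        have h1 := card_prevDarts (src := src) (tgt := tgt) hf
        have h2 := hdeg _ (dartRev_mem.2 hf)
        rw [dartHead_rev] at h2
        rw [← h1] at h2 ⊢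
        push_cast
        rw [add_sub_cancel_right, mul_inv_cancel₀, one_mul]
        have : 0 < ((darts T).filter fun d => f ∈ nextDarts src tgt T d).card := by omega
        exact_mod_cast this.ne'
      · intro d f
        simp only [Finset.mem_filter]
        constructor
        · rintro ⟨h1, h2⟩
          exact ⟨⟨h1, h2⟩, (mem_nextDarts.1 h2).1⟩
        · rintro ⟨⟨h1, h2⟩, -⟩
          exact ⟨h1, h2⟩
    have h := Finset.sum_le_sum hstep
    rw [Finset.sum_add_distrib, hstat] at h
    push_cast
    linarith

theorem sum_darts_dartHead {U : Finset V} (hs : ∀ e ∈ T, src e ∈ U) (ht : ∀ e ∈ T, tgt e ∈ U)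
    (φ : V → ℝ) : ∑ d ∈ darts T, φ (dartHead src tgt d) =
      ∑ v ∈ U, (degree src tgt T v : ℝ) * φ v := by
  classical
  have h1 : ∑ d ∈ darts T, φ (dartHead src tgt d) = ∑ d ∈ darts T, φ (dartTail src tgt d) :=
    Finset.sum_bij' (fun d _ => dartRev d) (fun d _ => dartRev d)
      (fun d hd => dartRev_mem.2 hd) (fun d hd => dartRev_mem.2 hd) (fun d _ => dartRev_rev d)
      (fun d _ => dartRev_rev d) (fun d _ => by rw [dartTail_rev])
  rw [h1, ← Finset.sum_fiberwise_of_maps_to (t := U) (g := dartTail src tgt)]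
  · refine Finset.sum_congr rfl fun v _ => ?_
    rw [Finset.sum_congr rfl fun d hd => by rw [(Finset.mem_filter.1 hd).2], Finset.sum_const,
      nsmul_eq_mul, degree, outDarts]
  · intro d hd
    have := mem_darts.1 hd
    unfold dartTail
    split_ifs
    exacts [hs _ this, ht _ this]

/-- Short non-backtracking walks are determined by their ends. -/
theorem GirthGT.sum_card_nbWalks_le (h : GirthGT src tgt T m) {U : Finset V}
    (hs : ∀ e ∈ T, src e ∈ U) (ht : ∀ e ∈ T, tgt e ∈ U) {t : ℕ} (htm : 2 * (t + 1) ≤ m) :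
    ∑ d ∈ darts T, (nbWalks src tgt T t d).card ≤ U.card * U.card := by
  classical
  have hU : ∀ d ∈ darts T, dartTail src tgt d ∈ U ∧ dartHead src tgt d ∈ U := by
    intro d hd
    have := mem_darts.1 hd
    unfold dartTail dartHead
    split_ifs
    exacts [⟨hs _ this, ht _ this⟩, ⟨ht _ this, hs _ this⟩]
  rw [← Finset.card_biUnion, ← Finset.card_product]
  · refine Finset.card_le_card_of_forall_subsingleton
      (fun w (p : V × V) => IsWalk src tgt p.1 w p.2) ?_ ?_
    · intro w hw
      obtain ⟨d, hd, hw⟩ := Finset.mem_biUnion.1 hw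
      obtain ⟨-, -, -, f, hf, hwalk⟩ := mem_nbWalks hd hw
      exact ⟨(_, _), Finset.mem_product.2 ⟨(hU d hd).1, (hU f hf).2⟩, hwalk⟩
    · rintro p - w₁ ⟨hw₁, hp₁⟩ w₂ ⟨hw₂, hp₂⟩
      obtain ⟨d₁, hd₁, hw₁⟩ := Finset.mem_biUnion.1 hw₁
      obtain ⟨d₂, hd₂, hw₂⟩ := Finset.mem_biUnion.1 hw₂
      obtain ⟨hl₁, hr₁, hT₁, -⟩ := mem_nbWalks hd₁ hw₁
      obtain ⟨hl₂, hr₂, hT₂, -⟩ := mem_nbWalks hd₂ hw₂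
      exact h.eq_of_isReduced hp₁ hp₂ hr₁ hr₂ hT₁ hT₂ (by omega)
  · intro d _ d' _ hdd'
    rw [Function.onFun, Finset.disjoint_left]
    intro w hw hw'
    obtain ⟨w₁, rfl⟩ := exists_cons_of_mem_nbWalks hw
    obtain ⟨w₂, h₂⟩ := exists_cons_of_mem_nbWalks hw'
    simp only [List.cons.injEq] at h₂
    exact hdd' h₂.1

/-- The Moore bound of Alon, Hoory and Linial, in logarithmic form: a graph of minimum degree at
least `2` and average degree `d` without cycles on at most `2s` edges has at least `(d - 1)^s`
vertices. -/
theorem GirthGT.moore_of_two_le_degree (h : GirthGT src tgt T m) {U : Finset V}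
    (hs : ∀ e ∈ T, src e ∈ U) (ht : ∀ e ∈ T, tgt e ∈ U)
    (hdeg : ∀ v ∈ U, 2 ≤ degree src tgt T v) (hU : U.Nonempty) {s : ℕ} (hsm : 2 * s ≤ m) :
    s * Real.log (2 * T.card / U.card - 1) ≤ Real.log U.card := by
  have hUpos : (0 : ℝ) < U.card := by exact_mod_cast hU.card_pos
  rcases s with _ | t
  · simpa using Real.log_natCast_nonneg _
  have hdeg' : ∀ d ∈ darts T, 2 ≤ degree src tgt T (dartHead src tgt d) := by
    intro d hd
    have := mem_darts.1 hd
    unfold dartHead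
    split_ifs
    exacts [hdeg _ (ht _ this), hdeg _ (hs _ this)]
  have hdegR : ∀ v ∈ U, (1 : ℝ) ≤ (degree src tgt T v : ℝ) - 1 := by
    intro v hv
    have : (2 : ℝ) ≤ degree src tgt T v := by exact_mod_cast hdeg v hv
    linarith
  have hsum : ∑ v ∈ U, (degree src tgt T v : ℝ) = 2 * T.card := by
    have := sum_darts_dartHead hs ht (fun _ => (1 : ℝ))
    simp only [Finset.sum_const, card_darts, nsmul_eq_mul, mul_one] at this
    rw [← this]
    push_cast
    ring
  have hTU : (U.card : ℝ) ≤ T.card := by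
    have : ∑ v ∈ U, (2 : ℝ) ≤ ∑ v ∈ U, (degree src tgt T v : ℝ) :=
      Finset.sum_le_sum fun v hv => by linarith [hdegR v hv]
    rw [hsum, Finset.sum_const, nsmul_eq_mul] at this
    linarith
  have hTpos : (0 : ℝ) < T.card := by linarith
  set a : ℝ := 2 * T.card / U.card - 1 with ha
  have ha1 : a + 1 = 2 * T.card / U.card := by rw [ha]; ring
  have ha_ge : 1 ≤ a := by
    rw [ha, le_sub_iff_add_le, le_div_iff₀ hUpos]
    linarith
  have hjensen : 2 * T.card * Real.log a ≤
      ∑ v ∈ U, (degree src tgt T v : ℝ) * Real.log ((degree src tgt T v : ℝ) - 1) := by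
    have := convexOn_add_one_mul_log.map_sum_le (t := U) (w := fun _ => (U.card : ℝ)⁻¹)
      (p := fun v => (degree src tgt T v : ℝ) - 1) (fun _ _ => by positivity)
      (by simp [hUpos.ne']) hdegR
    simp only [smul_eq_mul, ← Finset.mul_sum, Finset.sum_sub_distrib, hsum, Finset.sum_const,
      nsmul_eq_mul, mul_one, sub_add_cancel] at this
    have hmean : (U.card : ℝ)⁻¹ * (2 * T.card - U.card) = a := by
      rw [ha]
      field_simp
    rw [hmean, ha1, inv_mul_eq_div, le_div_iff₀ hUpos] at this
    refine le_trans (le_of_eq ?_) this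
    field_simp
  have hlog := sum_log_card_nbWalks hdeg' t
  rw [sum_darts_dartHead hs ht (fun v => Real.log ((degree src tgt T v : ℝ) - 1))] at hlog
  have hTne : (darts T).Nonempty := by
    rw [← Finset.card_pos, card_darts]
    have : 0 < T.card := by exact_mod_cast hTpos
    omega
  have hamgm := log_card_add_inv_mul_sum_log_le hTne
    (a := fun d => ((nbWalks src tgt T t d).card : ℝ))
    fun d hd => by exact_mod_cast card_nbWalks_pos hdeg' t d hd
  rw [card_darts] at hamgm
  push_cast at hamgm
  have hupper : Real.log (∑ d ∈ darts T, ((nbWalks src tgt T t d).card : ℝ)) ≤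
      Real.log U.card + Real.log U.card := by
    rw [← Real.log_mul hUpos.ne' hUpos.ne']
    refine Real.log_le_log (Finset.sum_pos (fun d hd => ?_) hTne) ?_
    · exact_mod_cast card_nbWalks_pos hdeg' t d hd
    · exact_mod_cast h.sum_card_nbWalks_le hs ht hsm
  have hgrow : t * Real.log a ≤
      (2 * T.card : ℝ)⁻¹ * ∑ d ∈ darts T, Real.log (nbWalks src tgt T t d).card := by
    rw [inv_mul_eq_div, le_div_iff₀ (by positivity)]
    have := mul_le_mul_of_nonneg_left hjensen (Nat.cast_nonneg (α := ℝ) t)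
    linarith
  have hdarts : Real.log (2 * T.card) = Real.log (a + 1) + Real.log U.card := by
    rw [ha1, Real.log_div (by positivity) hUpos.ne']
    ring
  have hmono : Real.log a ≤ Real.log (a + 1) := Real.log_le_log (by linarith) (by linarith)
  push_cast
  linarith

/-- Each graph contains a subgraph of minimum degree at least `2` whose edge surplus `|E| - |V|`
is at least as large: discard vertices of degree at most `1` together with their edges. -/
theorem exists_two_le_degree (T : Finset (Fin n)) (U : Finset V) (hs : ∀ e ∈ T, src e ∈ U)
    (ht : ∀ e ∈ T, tgt e ∈ U) : ∃ T' ⊆ T, ∃ U' ⊆ U, (∀ e ∈ T', src e ∈ U') ∧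
      (∀ e ∈ T', tgt e ∈ U') ∧ (∀ v ∈ U', 2 ≤ degree src tgt T' v) ∧
      T.card + U'.card ≤ T'.card + U.card := by
  classical
  induction U using Finset.strongInduction generalizing T with
  | H U ih =>
    by_cases hdeg : ∀ v ∈ U, 2 ≤ degree src tgt T v
    · exact ⟨T, subset_rfl, U, subset_rfl, hs, ht, hdeg, le_rfl⟩
    push Not at hdeg
    obtain ⟨v, hv, hlt⟩ := hdeg
    obtain ⟨T', hT', U', hU', hs', ht', hdeg', hcard⟩ := ih (U.erase v) (Finset.erase_ssubset hv)
      (T.filter fun e => ¬ (src e = v ∨ tgt e = v))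
      (fun e he => by
        obtain ⟨h1, h2⟩ := Finset.mem_filter.1 he
        exact Finset.mem_erase.2 ⟨fun h => h2 (Or.inl h), hs e h1⟩)
      (fun e he => by
        obtain ⟨h1, h2⟩ := Finset.mem_filter.1 he
        exact Finset.mem_erase.2 ⟨fun h => h2 (Or.inr h), ht e h1⟩)
    refine ⟨T', hT'.trans (Finset.filter_subset _ _), U', hU'.trans (Finset.erase_subset _ _), hs',
      ht', hdeg', ?_⟩
    have h1 := Finset.card_filter_add_card_filter_not (s := T) (fun e => src e = v ∨ tgt e = v)
    have h2 := Finset.card_erase_add_one hv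
    have h3 : (T.filter fun e => src e = v ∨ tgt e = v).card ≤ degree src tgt T v := by
      refine (Finset.card_le_card (t := (outDarts src tgt T v).image Prod.fst) ?_).trans
        Finset.card_image_le
      intro e he
      obtain ⟨he, h | h⟩ := Finset.mem_filter.1 he
      · exact Finset.mem_image.2 ⟨(e, true), mem_outDarts.2 ⟨mem_darts.2 he, by simpa [dartTail]⟩,
          rfl⟩
      · exact Finset.mem_image.2 ⟨(e, false), mem_outDarts.2 ⟨mem_darts.2 he, by simpa [dartTail]⟩,
          rfl⟩
    omega

/-- The Moore bound in terms of the edge surplus `|E| - |V|`. -/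
theorem GirthGT.moore (h : GirthGT src tgt T m) {U : Finset V} (hs : ∀ e ∈ T, src e ∈ U)
    (ht : ∀ e ∈ T, tgt e ∈ U) (hTU : U.card < T.card) {s : ℕ} (hsm : 2 * s ≤ m) :
    s * Real.log (1 + 2 * ((T.card : ℝ) - U.card) / n) ≤ Real.log n := by
  obtain ⟨T', hT', U', hU', hs', ht', hdeg, hcard⟩ := exists_two_le_degree T U hs ht
  have hcard' : U'.card < T'.card := by omega
  have hn : T'.card ≤ n := by simpa using T'.card_le_univ
  have hT'ne : T'.Nonempty := Finset.card_pos.1 (by omega)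
  have hU'ne : U'.Nonempty := hT'ne.elim fun e he => ⟨src e, hs' e he⟩
  have hU'pos : (0 : ℝ) < U'.card := by exact_mod_cast hU'ne.card_pos
  have hU'n : (U'.card : ℝ) ≤ n := by exact_mod_cast hcard'.le.trans hn
  have hTUR : (U.card : ℝ) < T.card := by exact_mod_cast hTU
  have hsurplus : (T.card : ℝ) - U.card ≤ (T'.card : ℝ) - U'.card := by
    have : (T.card : ℝ) + U'.card ≤ T'.card + U.card := by exact_mod_cast hcard
    linarith
  have hkey := (h.mono hT').moore_of_two_le_degree hs' ht' hdeg hU'ne hsm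
  have hratio : 1 + 2 * ((T.card : ℝ) - U.card) / n ≤ 2 * T'.card / U'.card - 1 := by
    have h1 : (2 * T'.card / U'.card - 1 : ℝ) = 1 + 2 * ((T'.card : ℝ) - U'.card) / U'.card := by
      field_simp
      ring
    rw [h1]
    gcongr
    linarith
  have hpos : 0 < 1 + 2 * ((T.card : ℝ) - U.card) / n := by
    have : 0 ≤ 2 * ((T.card : ℝ) - U.card) / n :=
      div_nonneg (by linarith) (Nat.cast_nonneg n)
    linarith
  calc s * Real.log (1 + 2 * ((T.card : ℝ) - U.card) / n)
      ≤ s * Real.log (2 * T'.card / U'.card - 1) :=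
        mul_le_mul_of_nonneg_left (Real.log_le_log hpos hratio) (Nat.cast_nonneg s)
    _ ≤ Real.log U'.card := hkey
    _ ≤ Real.log n := Real.log_le_log hU'pos hU'n

end Moore

/-! ### The codespace as gauge-invariant functions on flat connections -/

section Codespace

variable {V : Type v} {n : ℕ} (Γ : GhostComplex V n)

namespace GhostComplex

/-- The quotient map on vertices that identifies all ghost vertices with one extra vertex
`none`. -/
noncomputable def collapse (x : V) : Option V :=
  open Classical in if x ∈ Γ.ghost then none else some x

/-- The source map of the graph in which the ghost vertices are identified. -/
noncomputable def csrc : Fin n → Option V := Γ.collapse ∘ Γ.src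

/-- The target map of the graph in which the ghost vertices are identified. -/
noncomputable def ctgt : Fin n → Option V := Γ.collapse ∘ Γ.tgt

/-- The flat connections: those with trivial holonomy around each 2-cell. -/
def flat (G : Type u) [Group G] : Set (Fin n → G) := {g | ∀ w ∈ Γ.faces, evalWord g w = 1}

variable {G : Type u} [Group G]

theorem gauge_mem_flat_iff (h : Option V → G) (g : Fin n → G) :
    gauge Γ.csrc Γ.ctgt h g ∈ Γ.flat G ↔ g ∈ Γ.flat G := by
  refine forall₂_congr fun w hw => ?_
  obtain ⟨x, hx⟩ := Γ.faces_closed w hw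
  exact evalWord_gauge_eq_one_iff h g (hx.map Γ.collapse)

theorem vertexVec_eq_gauge [DecidableEq (Option V)] {x : V} (hx : x ∉ Γ.ghost) (h : G)
    (g : Fin n → G) : (vertexVec Γ.src x h)⁻¹ * g * vertexVec Γ.tgt x h =
      gauge Γ.csrc Γ.ctgt (Pi.mulSingle (some x) h⁻¹) g := by
  have key : ∀ y : V, (Pi.mulSingle (some x) h⁻¹ : Option V → G) (Γ.collapse y) =
      open Classical in if y = x then h⁻¹ else 1 := by
    intro y
    by_cases hy : y ∈ Γ.ghost
    · have : y ≠ x := fun e => hx (e ▸ hy)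
      simp [collapse, hy, this]
    · rw [show Γ.collapse y = some y from if_neg hy]
      by_cases hyx : y = x
      · simp [hyx]
      · simp [hyx]
  funext q
  simp only [gauge, csrc, ctgt, Function.comp_apply, key, Pi.mul_apply, Pi.inv_apply, vertexVec]
  split_ifs <;> simp

variable [Fintype G]

theorem mem_codespace_iff [Finite V] {ψ : Hilb G n} :
    ψ ∈ (Γ.quantumDouble G).codespace ↔
      (∀ h : Option V → G, h none = 1 → ∀ g, ψ (gauge Γ.csrc Γ.ctgt h g) = ψ g) ∧
        ∀ g ∉ Γ.flat G, ψ g = 0 := by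
  classical
  constructor
  · rintro ⟨hx, hz⟩
    refine ⟨?_, ?_⟩
    · -- the gauge transformations that fix `ψ` form a group, which contains the generators
      let S : Subgroup (Option V → G) :=
        { carrier := {h | ∀ g, ψ (gauge Γ.csrc Γ.ctgt h g) = ψ g}
          one_mem' := fun g => by rw [gauge_one]
          mul_mem' := fun {a b} ha hb g => by rw [gauge_mul, ha, hb]
          inv_mem' := fun {a} ha g => by rw [← ha, ← gauge_mul, mul_inv_cancel, gauge_one] }
      intro h hh
      have : h ∈ S := by
        refine Subgroup.pi_mem_of_mulSingle_mem h fun x => ?_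
        rcases x with _ | x
        · rw [hh, Pi.mulSingle_one]
          exact S.one_mem
        by_cases hxg : x ∈ Γ.ghost
        · -- a ghost vertex is no end of an edge in the collapsed graph
          intro g
          have key : ∀ y : V, (Pi.mulSingle (some x) (h (some x)) : Option V → G)
              (Γ.collapse y) = 1 := by
            intro y
            rw [Pi.mulSingle_apply, if_neg]
            unfold collapse
            split_ifs with hy
            · simp
            · rintro ⟨rfl⟩
              exact hy hxg
          have hfix : gauge Γ.csrc Γ.ctgt (Pi.mulSingle (some x) (h (some x))) g = g := by
            funext q
            simp [gauge, csrc, ctgt, key]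
          rw [hfix]
        · intro g
          have h1 := hx _ ⟨x, hxg, (h (some x))⁻¹, rfl⟩
          have h2 := congrArg (fun φ : Hilb G n => φ g) h1
          rw [← inv_inv (h (some x)), ← vertexVec_eq_gauge Γ hxg]
          exact h2
      exact this
    · intro g hg
      simp only [flat, Set.mem_ofPred_eq, not_forall] at hg
      obtain ⟨w, hw, hne⟩ := hg
      have h1 := congrArg (fun φ : Hilb G n => φ g) (hz (⊥, w) ⟨w, hw, rfl⟩)
      simpa [zOp, Subgroup.mem_bot, hne] using h1.symm
  · rintro ⟨hgauge, hflat⟩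
    refine ⟨?_, ?_⟩
    · rintro _ ⟨x, hx, h, rfl⟩
      ext g
      have := hgauge (Pi.mulSingle (some x) h⁻¹) (by simp) g
      rw [← vertexVec_eq_gauge Γ hx] at this
      exact this
    · rintro _ ⟨w, hw, rfl⟩
      ext g
      by_cases hg : evalWord g w = 1
      · simp [zOp, hg]
      · have : ψ g = 0 := hflat g fun hf => hg (hf w hw)
        simp [zOp, Subgroup.mem_bot, hg, this]

/-- The indicator function of a gauge-invariant set of flat connections is a code state. -/
theorem indicator_mem_codespace [Finite V] {P : Set (Fin n → G)} (hP : P ⊆ Γ.flat G)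
    (hinv : ∀ h : Option V → G, ∀ g, gauge Γ.csrc Γ.ctgt h g ∈ P ↔ g ∈ P) :
    (WithLp.toLp 2 (P.indicator fun _ => (1 : ℂ)) : Hilb G n) ∈
      (Γ.quantumDouble G).codespace := by
  classical
  refine (Γ.mem_codespace_iff).2 ⟨fun h _ g => ?_, fun g hg => ?_⟩
  · simp [Set.indicator_apply, hinv]
  · simp [mt (@hP g) hg]

/-- The holonomy along a closed walk distinguishes the trivial connection from those flat
connections on which it is nontrivial. So, if the corresponding `Z`-type operator obeys
Knill–Laflamme, the holonomy is trivial on all flat connections. -/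
theorem evalWord_eq_one_of_knillLaflamme [Finite V] {w : QWord n} {x : Option V}
    (hw : IsWalk Γ.csrc Γ.ctgt x w x)
    (hKL : KnillLaflamme (Γ.quantumDouble G).codespace (zOp ⊥ w)) :
    ∀ g ∈ Γ.flat G, evalWord g w = 1 := by
  classical
  obtain ⟨c, hc⟩ := hKL
  have hone : (1 : Fin n → G) ∈ {g ∈ Γ.flat G | evalWord g w = 1} :=
    ⟨fun w' _ => evalWord_one w', evalWord_one w⟩
  have hψ := Γ.indicator_mem_codespace (P := {g ∈ Γ.flat G | evalWord g w = 1})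
    (fun g hg => hg.1) fun h g =>
      and_congr (Γ.gauge_mem_flat_iff h g) (evalWord_gauge_eq_one_iff h g hw)
  have hφ := Γ.indicator_mem_codespace (P := {g ∈ Γ.flat G | evalWord g w ≠ 1})
    (fun g hg => hg.1) fun h g =>
      and_congr (Γ.gauge_mem_flat_iff h g) (not_congr (evalWord_gauge_eq_one_iff h g hw))
  generalize hψd : (WithLp.toLp 2 (Set.indicator {g ∈ Γ.flat G | evalWord g w = 1}
    fun _ => (1 : ℂ)) : Hilb G n) = ψ at hψ
  generalize hφd : (WithLp.toLp 2 (Set.indicator {g ∈ Γ.flat G | evalWord g w ≠ 1}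
    fun _ => (1 : ℂ)) : Hilb G n) = φ at hφ
  have hzψ : zOp ⊥ w ψ = ψ := by
    ext g
    by_cases hg : evalWord g w = 1 <;> simp [zOp, ← hψd, Subgroup.mem_bot, hg]
  have hzφ : zOp ⊥ w φ = 0 := by
    ext g
    by_cases hg : evalWord g w = 1 <;> simp [zOp, ← hφd, Subgroup.mem_bot, hg]
  have hψ0 : ψ ≠ 0 := by
    intro h0
    have := congrArg (fun φ : Hilb G n => φ 1) h0
    rw [← hψd] at this
    simp only [Set.indicator_of_mem hone] at this
    simp at this
  have hc1 : c = 1 := by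
    have := hc ψ hψ ψ hψ
    rw [hzψ] at this
    exact (mul_eq_right₀ (inner_self_ne_zero.2 hψ0)).1 this.symm
  have hφ0 : φ = 0 := by
    have := hc φ hφ φ hφ
    rw [hzφ, hc1, one_mul, inner_zero_right] at this
    exact inner_self_eq_zero.1 this.symm
  intro g hg
  by_contra hne
  have := congrArg (fun φ : Hilb G n => φ g) hφ0
  rw [← hφd] at this
  simp [hg, hne] at this

end GhostComplex

end Codespace

/-! ### Counting gauge orbits -/

section Dimension

variable {W : Type v} {n : ℕ} {src tgt : Fin n → W}

/-- On a connected graph the gauge transformations that are trivial at a root act freely on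
connections. So the dimension of a space of invariant functions supported on `F` is at most
`|F| / |G|^(|U| - 1)`, and `|F| ≤ |G|^|T|` if the connections in `F` are determined on `T`. -/
theorem finrank_mul_pow_le {G : Type u} [Group G] [Fintype G] {U : Finset W} {w₀ : W}
    (hw₀ : w₀ ∈ U) {F : Set (Fin n → G)}
    (hF : ∀ h : W → G, h w₀ = 1 → ∀ g ∈ F, gauge src tgt h g ∈ F) {C : Submodule ℂ (Hilb G n)}
    (hC : ∀ ψ ∈ C, ∀ h : W → G, h w₀ = 1 → ∀ g, ψ (gauge src tgt h g) = ψ g)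
    (hC₀ : ∀ ψ ∈ C, ∀ g ∉ F, ψ g = 0) {T : Finset (Fin n)}
    (hT : ∀ g ∈ F, ∀ g' ∈ F, (∀ q ∈ T, g q = g' q) → g = g')
    (hconn : ∀ c : Set W, IsEdgeClosed src tgt T c → w₀ ∈ c → ∀ z ∈ U, z ∈ c) :
    Module.finrank ℂ C * Fintype.card G ^ (U.card - 1) ≤ Fintype.card G ^ T.card := by
  classical
  let H := {z // z ∈ U.erase w₀} → G
  let ext : H → W → G := fun h z => if hz : z ∈ U.erase w₀ then h ⟨z, hz⟩ else 1
  have ext_root : ∀ h : H, ext h w₀ = 1 := fun h => by simp [ext]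
  have ext_one : ext 1 = 1 := by
    funext z
    by_cases hz : z ∈ U.erase w₀
    · simp only [ext, dif_pos hz]
      rfl
    · simp only [ext, dif_neg hz, Pi.one_apply]
  have ext_mul : ∀ h₁ h₂ : H, ext (h₁ * h₂) = ext h₁ * ext h₂ := by
    intro h₁ h₂
    funext z
    by_cases hz : z ∈ U.erase w₀
    · simp only [ext, Pi.mul_apply, dif_pos hz]
      rfl
    · simp only [ext, Pi.mul_apply, dif_neg hz, mul_one]
  let _ : MulAction H F :=
    { smul := fun h g => ⟨gauge src tgt (ext h) g, hF _ (ext_root h) g g.2⟩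
      one_smul := fun g => Subtype.ext (by
        change gauge src tgt (ext 1) g = g
        rw [ext_one, gauge_one])
      mul_smul := fun h₁ h₂ g => Subtype.ext (by
        change gauge src tgt (ext (h₁ * h₂)) g = gauge src tgt (ext h₁) (gauge src tgt (ext h₂) g)
        rw [ext_mul, gauge_mul]) }
  have hsmul : ∀ (h : H) (g : F), ((h • g : F) : Fin n → G) = gauge src tgt (ext h) g :=
    fun _ _ => rfl
  have hfree : ∀ g : F, MulAction.stabilizer H g = ⊥ := by
    intro g
    rw [eq_bot_iff]
    intro h hh
    have hg : gauge src tgt (ext h) g = g := by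
      rw [← hsmul]
      exact congrArg Subtype.val (MulAction.mem_stabilizer_iff.1 hh)
    -- where `h` fixes a connection, the set `h = 1` is a union of components
    have hclosed : IsEdgeClosed src tgt T {z | ext h z = 1} := by
      intro e _
      have he := congrFun hg e
      simp only [gauge] at he
      simp only [Set.mem_ofPred_eq]
      constructor
      · intro h1
        simpa [h1] using he
      · intro h1
        simpa [h1] using he
    rw [Subgroup.mem_bot]
    funext z
    have := hconn _ hclosed (ext_root h) z (Finset.mem_of_mem_erase z.2)
    simp only [Set.mem_ofPred_eq, ext, dif_pos z.2] at this
    exact this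
  have e := MulAction.selfEquivOrbitsQuotientProd hfree
  set Ω := Quotient (MulAction.orbitRel H F) with hΩ
  have hcardF : Nat.card F = Nat.card Ω * Fintype.card G ^ (U.card - 1) := by
    rw [Nat.card_congr e, Nat.card_prod]
    congr 1
    rw [← Finset.card_erase_of_mem hw₀, Nat.card_fun, Nat.card_eq_fintype_card,
      Nat.card_eq_fintype_card, Fintype.card_coe]
  have hFle : Nat.card F ≤ Fintype.card G ^ T.card := by
    have hinj : Function.Injective (fun (g : F) (q : T) => (g : Fin n → G) q) := by
      intro g g' hgg'
      exact Subtype.ext (hT g g.2 g' g'.2 fun q hq => congrFun hgg' ⟨q, hq⟩)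
    have := Nat.card_le_card_of_injective _ hinj
    simpa using this
  have hdim : Module.finrank ℂ C ≤ Nat.card Ω := by
    let L : C →ₗ[ℂ] (Ω → ℂ) :=
      { toFun := fun ψ o => (ψ : Hilb G n) (o.out : F)
        map_add' := fun ψ φ => by
          funext o
          simp
        map_smul' := fun c ψ => by
          funext o
          simp }
    have hL : Function.Injective L := by
      rw [injective_iff_map_eq_zero]
      intro ψ hψ
      refine Subtype.ext ?_
      ext g
      change (ψ : Hilb G n) g = 0
      by_cases hg : g ∈ F
      · obtain ⟨h, hh⟩ := MulAction.orbitRel_apply.1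
          (Quotient.exact (Quotient.out_eq (Quotient.mk (MulAction.orbitRel H F) ⟨g, hg⟩)))
        have h1 := hC ψ ψ.2 (ext h) (ext_root h) g
        have h2 : gauge src tgt (ext h) g =
            ((Quotient.mk (MulAction.orbitRel H F) ⟨g, hg⟩).out : F) := congrArg Subtype.val hh
        rw [← h1, h2]
        exact congrFun hψ _
      · exact hC₀ ψ ψ.2 g hg
    have := Fintype.ofFinite Ω
    have hle := LinearMap.finrank_le_finrank_of_injective hL
    rwa [Module.finrank_fintype_fun_eq_card, ← Nat.card_eq_fintype_card] at hle
  calc Module.finrank ℂ C * Fintype.card G ^ (U.card - 1)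
      ≤ Nat.card Ω * Fintype.card G ^ (U.card - 1) := Nat.mul_le_mul_right _ hdim
    _ ≤ Fintype.card G ^ T.card := hcardF ▸ hFle

/-- Vertices of different components can be identified, without creating short cycles, until the
graph is connected. -/
theorem GirthGT.exists_connected [Finite W] {T : Finset (Fin n)} {m : ℕ}
    (h : GirthGT src tgt T m) (w₀ : W) : ∃ f : W → W, GirthGT (f ∘ src) (f ∘ tgt) T m ∧
      ∀ c : Set W, IsEdgeClosed (f ∘ src) (f ∘ tgt) T c → f w₀ ∈ c → ∀ z, f z ∈ c := by
  classical
  have := Fintype.ofFinite W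
  obtain ⟨f, hf, hmin⟩ := Set.exists_min_image {f : W → W | GirthGT (f ∘ src) (f ∘ tgt) T m}
    (fun f => (Finset.univ.image f).card) (Set.toFinite _) ⟨id, h⟩
  refine ⟨f, hf, fun c hc h₀ z => ?_⟩
  by_contra hz
  have hne : f w₀ ≠ f z := fun e => hz (e ▸ h₀)
  have hle := hmin (mergeTo (f w₀) (f z) ∘ f) (hf.merge hc h₀ hz)
  rw [← Finset.image_image] at hle
  have hlt := hle.trans (Finset.card_le_card (mergeTo_image_subset (by simp) hne))
  have := Finset.card_erase_add_one (s := Finset.univ.image f) (a := f z) (by simp)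
  omega

end Dimension

/-! ### Distance bounds -/

namespace GhostComplex

variable {V : Type v} [Finite V] {n : ℕ} (Γ : GhostComplex V n) {G : Type u} [Group G] [Fintype G]

/-- In a code of `Z`-distance greater than `m` the flat connections are determined by their values
on a set of edges without cycles of at most `m` edges. -/
theorem exists_girthGT_determining {m : ℕ} (hm : (m : ℕ∞) < (Γ.quantumDouble G).zDistance) :
    ∃ T : Finset (Fin n), GirthGT Γ.csrc Γ.ctgt T m ∧
      ∀ g ∈ Γ.flat G, ∀ g' ∈ Γ.flat G, (∀ q ∈ T, g q = g' q) → g = g' := by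
  classical
  have hKL := ((Γ.quantumDouble G).lt_zDistance_iff m).1 hm
  obtain ⟨T, hT, hmin⟩ := Set.exists_min_image {T : Finset (Fin n) | ∀ g ∈ Γ.flat G,
    ∀ g' ∈ Γ.flat G, (∀ q ∈ T, g q = g' q) → g = g'} Finset.card (Set.toFinite _)
    ⟨Finset.univ, fun g _ g' _ h => funext fun q => h q (Finset.mem_univ q)⟩
  refine ⟨T, fun e he p hp hl => ?_, hT⟩
  by_contra! hcard
  have hsupp : (wordSupport ((e, true) :: p)).card ≤ m := by
    have : wordSupport ((e, true) :: p) = insert e (wordSupport p) := by simp [wordSupport]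
    rw [this]
    exact (Finset.card_insert_le _ _).trans hcard
  have hwalk : IsWalk Γ.csrc Γ.ctgt (Γ.csrc e) ((e, true) :: p) (Γ.csrc e) := ⟨rfl, hp⟩
  have htriv := Γ.evalWord_eq_one_of_knillLaflamme hwalk (hKL ⊥ _ hsupp)
  -- the value on `e` is the inverse of the holonomy along `p`, so `e` is redundant in `T`
  have hval : ∀ g ∈ Γ.flat G, g e = (evalWord g p)⁻¹ := by
    intro g hg
    have := htriv g hg
    rw [evalWord_cons] at this
    exact eq_inv_of_mul_eq_one_left this
  have hle := hmin (T.erase e) fun g hg g' hg' hgg' => hT g hg g' hg' fun q hq => by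
    by_cases hqe : q = e
    · rw [hqe, hval g hg, hval g' hg', evalWord_congr fun l hlp =>
        hgg' l.1 (Finset.mem_erase.2 ⟨(hl l hlp).2, (hl l hlp).1⟩)]
    · exact hgg' q (Finset.mem_erase.2 ⟨hqe, hq⟩)
  have := Finset.card_erase_add_one he
  omega

/-- A code of `Z`-distance greater than `m` yields a graph without cycles on at most `m` edges whose
cyclomatic number `|E| - |V| + 1` is at least the log-dimension of the code. -/
theorem exists_girthGT_logDim_le {m : ℕ} (hm : (m : ℕ∞) < (Γ.quantumDouble G).zDistance)
    (hk : 0 < (Γ.quantumDouble G).logDim) :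
    ∃ (src tgt : Fin n → Option V) (T : Finset (Fin n)) (U : Finset (Option V)),
      GirthGT src tgt T m ∧ (∀ e ∈ T, src e ∈ U) ∧ (∀ e ∈ T, tgt e ∈ U) ∧ U.Nonempty ∧
        (Γ.quantumDouble G).logDim ≤ (T.card : ℝ) - U.card + 1 := by
  classical
  have := Fintype.ofFinite (Option V)
  obtain ⟨T, hgirth, hdet⟩ := Γ.exists_girthGT_determining hm
  obtain ⟨f, hf, hconn⟩ := hgirth.exists_connected none
  refine ⟨f ∘ Γ.csrc, f ∘ Γ.ctgt, T, Finset.univ.image f, hf, by simp, by simp, by simp, ?_⟩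
  have hw₀ : f none ∈ Finset.univ.image f := by simp
  have hdim := finrank_mul_pow_le (src := f ∘ Γ.csrc) (tgt := f ∘ Γ.ctgt) hw₀ (F := Γ.flat G)
    (fun h _ g hg => (Γ.gauge_mem_flat_iff (h ∘ f) g).2 hg)
    (C := (Γ.quantumDouble G).codespace)
    (fun ψ hψ h hh g => (Γ.mem_codespace_iff.1 hψ).1 (h ∘ f) hh g)
    (fun ψ hψ => (Γ.mem_codespace_iff.1 hψ).2) hdet
    (fun c hc h₀ z hz => by
      obtain ⟨y, -, rfl⟩ := Finset.mem_image.1 hz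
      exact hconn c hc h₀ y)
  have hU : 0 < (Finset.univ.image f).card := Finset.card_pos.2 ⟨_, hw₀⟩
  generalize (Finset.univ.image f).card = u at hdim hU
  unfold GroupCSSCode.logDim at hk ⊢
  generalize Module.finrank ℂ (Γ.quantumDouble G).codespace = D at hdim hk ⊢
  have hG : 1 < Fintype.card G := by
    by_contra! h
    have : Fintype.card G = 1 := le_antisymm h Fintype.card_pos
    simp [this] at hk
  have hD : 0 < D := by
    rcases Nat.eq_zero_or_pos D with rfl | h
    · simp at hk
    · exact h
  have hGR : (1 : ℝ) < Fintype.card G := by exact_mod_cast hG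
  have hdimR : (D : ℝ) * (Fintype.card G : ℝ) ^ (u - 1) ≤ (Fintype.card G : ℝ) ^ T.card := by
    exact_mod_cast hdim
  have hDR : (0 : ℝ) < D := by exact_mod_cast hD
  have hlog := Real.logb_le_logb_of_le hGR (by positivity) hdimR
  rw [Real.logb_mul hDR.ne' (by positivity), Real.logb_pow, Real.logb_pow,
    Real.logb_self_eq_one hGR, mul_one, mul_one, Nat.cast_sub hU] at hlog
  push_cast at hlog
  linarith

theorem add_one_le_of_lt_zDistance {m : ℕ} (hm : (m : ℕ∞) < (Γ.quantumDouble G).zDistance)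
    (hk : 1 < (Γ.quantumDouble G).logDim) :
    (m : ℝ) + 1 ≤ 2 + 2 * Real.log n /
      Real.log (1 + 2 * ((Γ.quantumDouble G).logDim - 1) / n) := by
  obtain ⟨src, tgt, T, U, hgirth, hs, ht, -, hle⟩ :=
    Γ.exists_girthGT_logDim_le hm (zero_lt_one.trans hk)
  have hTU : U.card < T.card := by
    have : (U.card : ℝ) < T.card := by linarith
    exact_mod_cast this
  have hn : (0 : ℝ) < n := by
    have : T.card ≤ n := by simpa using T.card_le_univ
    exact_mod_cast (by omega : 0 < n)
  have hmoore := hgirth.moore hs ht hTU (s := m / 2) (by omega)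
  set k := (Γ.quantumDouble G).logDim
  have hx : 0 < 2 * (k - 1) / n := div_pos (by linarith) hn
  have hL : 0 < Real.log (1 + 2 * (k - 1) / n) := Real.log_pos (by linarith)
  have hmono : Real.log (1 + 2 * (k - 1) / n) ≤
      Real.log (1 + 2 * ((T.card : ℝ) - U.card) / n) := by
    have hle' : k - 1 ≤ (T.card : ℝ) - U.card := by linarith
    refine Real.log_le_log (by linarith) ?_
    generalize (T.card : ℝ) - U.card = b at hle'
    generalize k - 1 = b' at hle'
    gcongr
  have hs' : ((m / 2 : ℕ) : ℝ) ≤ Real.log n / Real.log (1 + 2 * (k - 1) / n) := by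
    rw [le_div_iff₀ hL]
    exact (mul_le_mul_of_nonneg_left hmono (Nat.cast_nonneg _)).trans hmoore
  have hfloor : (m : ℝ) + 1 ≤ 2 * ((m / 2 : ℕ) : ℝ) + 2 := by
    exact_mod_cast (by omega : m + 1 ≤ 2 * (m / 2) + 2)
  rw [mul_div_assoc]
  linarith

theorem logDim_mul_le_of_lt_zDistance {m : ℕ} (hm : (m : ℕ∞) < (Γ.quantumDouble G).zDistance)
    (hk : 0 < (Γ.quantumDouble G).logDim) (hn : 2 ≤ n) :
    (Γ.quantumDouble G).logDim * ((m : ℝ) + 1) ≤ 8 * (n * Real.log n) := by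
  obtain ⟨src, tgt, T, U, hgirth, hs, ht, hU, hle⟩ := Γ.exists_girthGT_logDim_le hm hk
  have hTn : T.card ≤ n := by simpa using T.card_le_univ
  have hmn : m + 1 ≤ n := by
    -- otherwise the graph is a forest, which has cyclomatic number `0`
    by_contra! h
    have : T.card + 1 ≤ U.card := hgirth.card_lt_card U (by omega) hU hs ht
    have : (T.card : ℝ) + 1 ≤ U.card := by exact_mod_cast this
    linarith
  have hU1 : (1 : ℝ) ≤ U.card := by exact_mod_cast hU.card_pos
  have hTnR : (T.card : ℝ) ≤ n := by exact_mod_cast hTn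
  have hnR : (2 : ℝ) ≤ n := by exact_mod_cast hn
  have hmnR : (m : ℝ) + 1 ≤ n := by exact_mod_cast hmn
  have hlogn : 1 / 2 ≤ Real.log n :=
    le_trans (by linarith [Real.log_two_gt_d9]) (Real.log_le_log two_pos hnR)
  have hnlog : (n : ℝ) ≤ 2 * (n * Real.log n) := by nlinarith
  set k := (Γ.quantumDouble G).logDim
  rcases le_or_gt k 2 with hk2 | hk2
  · have : k * ((m : ℝ) + 1) ≤ 2 * n :=
      mul_le_mul hk2 hmnR (by positivity) zero_le_two
    linarith
  · have hTU : U.card < T.card := by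
      have : (U.card : ℝ) < T.card := by linarith
      exact_mod_cast this
    have hmoore := hgirth.moore hs ht hTU (s := m / 2) (by omega)
    have hkn : k ≤ n := by linarith
    -- as `k / n ≤ 1` and `2 (k - 1) ≥ k`, the logarithm is at least `k / (2 n)`
    have hlower : k / (2 * n) ≤ Real.log (1 + 2 * ((T.card : ℝ) - U.card) / n) := by
      have hx0 : 0 < k / n := by positivity
      have hx1 : k / n ≤ 1 := (div_le_one (by linarith)).2 hkn
      have h1 := Real.one_sub_inv_le_log_of_pos (x := 1 + k / n) (by linarith)
      have h2 : k / (2 * n) ≤ 1 - (1 + k / n)⁻¹ := by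
        have h3 : 1 - (1 + k / n)⁻¹ = (k / n) / (1 + k / n) := by
          field_simp
          ring
        rw [h3, mul_comm, ← div_div]
        exact div_le_div_of_nonneg_left hx0.le (by linarith) (by linarith)
      refine h2.trans (h1.trans (Real.log_le_log (by linarith) ?_))
      gcongr
      linarith
    have hs' : ((m / 2 : ℕ) : ℝ) * k ≤ 2 * (n * Real.log n) := by
      have := (mul_le_mul_of_nonneg_left hlower (Nat.cast_nonneg (m / 2))).trans hmoore
      rw [← mul_div_assoc, div_le_iff₀ (by linarith)] at this
      linarith
    have hfloor : (m : ℝ) + 1 ≤ 2 * ((m / 2 : ℕ) : ℝ) + 2 := by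
      exact_mod_cast (by omega : m + 1 ≤ 2 * (m / 2) + 2)
    have := mul_le_mul_of_nonneg_left hfloor hk.le
    linarith

end GhostComplex

theorem exists_eq_natCast_of_forall_lt {D : ℕ∞} {B : ℝ} (hB : 0 ≤ B)
    (h : ∀ m : ℕ, (m : ℕ∞) < D → (m : ℝ) + 1 ≤ B) : ∃ d : ℕ, D = d ∧ (d : ℝ) ≤ B := by
  induction D using ENat.recTopCoe with
  | top =>
    obtain ⟨m, hm⟩ := exists_nat_gt B
    have := h m (ENat.natCast_lt_top m)
    linarith
  | coe d =>
    refine ⟨d, rfl, ?_⟩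
    rcases d with _ | m
    · simpa using hB
    · simpa using h m (by exact_mod_cast Nat.lt_succ_self m)

end GroupCode

theorem mainTheorem2 :
    (∀ (G : Type u) [Group G] [Fintype G] (V : Type v) [Finite V] (n : ℕ)
        (Γ : GroupCode.GhostComplex V n),
      1 < (Γ.quantumDouble G).logDim →
        ∃ d : ℕ, (Γ.quantumDouble G).zDistance = (d : ℕ∞) ∧
          (d : ℝ) ≤ 2 + 2 * Real.log (n : ℝ) /
            Real.log (1 + 2 * ((Γ.quantumDouble G).logDim - 1) / (n : ℝ))) ∧
    (∃ A : ℝ, 0 < A ∧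
      ∀ (G : Type u) [Group G] [Fintype G] (V : Type v) [Finite V] (n : ℕ)
        (Γ : GroupCode.GhostComplex V n),
      2 ≤ n → 0 < (Γ.quantumDouble G).logDim →
        ∃ d : ℕ, (Γ.quantumDouble G).zDistance = (d : ℕ∞) ∧
          (Γ.quantumDouble G).logDim * (d : ℝ) ≤ A * ((n : ℝ) * Real.log (n : ℝ))) := by
  constructor
  · intro G _ _ V _ n Γ hk
    refine GroupCode.exists_eq_natCast_of_forall_lt ?_ fun m hm =>
      Γ.add_one_le_of_lt_zDistance hm hk
    have hx : 0 ≤ 2 * ((Γ.quantumDouble G).logDim - 1) / (n : ℝ) :=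
      div_nonneg (by linarith) (Nat.cast_nonneg n)
    have := div_nonneg (mul_nonneg zero_le_two (Real.log_natCast_nonneg n))
      (Real.log_nonneg (le_add_of_nonneg_right hx))
    linarith
  · refine ⟨8, by norm_num, fun G _ _ V _ n Γ hn hk => ?_⟩
    obtain ⟨d, hd, hle⟩ := GroupCode.exists_eq_natCast_of_forall_lt
      (D := (Γ.quantumDouble G).zDistance)
      (B := 8 * ((n : ℝ) * Real.log n) / (Γ.quantumDouble G).logDim)
      (div_nonneg (by have := Real.log_natCast_nonneg n; positivity) hk.le) fun m hm => by
        rw [le_div_iff₀ hk, mul_comm]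
        exact Γ.logDim_mul_le_of_lt_zDistance hm hk hn
    refine ⟨d, hd, ?_⟩
    rwa [le_div_iff₀ hk, mul_comm] at hle
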